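/- A permutation $w=w_1\cdots w_n$ of $\{1,\dots,n\}$ is a Baxter permutation if it avoids the vincular patterns 3-14-2 and 2-41-3; that is, there are no indices $i<j<j+1<k$ with $w_j<w_k<w_i<w_{j+1}$, and none with $w_{j+1}<w_i<w_k<w_j$. Let $n\ge 1$. The number of Baxter permutations of length $n$ whose permutation matrix is fixed under rotation by $90^\circ$ equals $2^m C_m$ if $n=4m+1$ for an integer $m\ge 0$, where $C_m=\frac{1}{m+1}\binom{2m}{m}$ is the $m$-th Catalan number, and equals $0$ if $n$ is not of this form. -/

import Mathlib

/-- An occurrence of the vincular pattern 3-14-2 in `w`: positions `i < j < j + 1 < k` with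
`w j < w k < w i < w (j + 1)`. Here `j'` is the position `j + 1`. -/
def Contains3142 {n : ℕ} (w : Equiv.Perm (Fin n)) : Prop :=
  ∃ i j j' k : Fin n, i < j ∧ (j' : ℕ) = (j : ℕ) + 1 ∧ j' < k ∧
    w j < w k ∧ w k < w i ∧ w i < w j'

/-- An occurrence of the vincular pattern 2-41-3 in `w`: positions `i < j < j + 1 < k` with
`w (j + 1) < w i < w k < w j`. Here `j'` is the position `j + 1`. -/
def Contains2413 {n : ℕ} (w : Equiv.Perm (Fin n)) : Prop :=
  ∃ i j j' k : Fin n, i < j ∧ (j' : ℕ) = (j : ℕ) + 1 ∧ j' < k ∧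
    w j' < w i ∧ w i < w k ∧ w k < w j

/-- Baxter permutations: those avoiding 3-14-2 and 2-41-3. -/
def IsBaxter {n : ℕ} (w : Equiv.Perm (Fin n)) : Prop :=
  ¬ Contains3142 w ∧ ¬ Contains2413 w

/-- Clockwise rotation of a square matrix by 90 degrees: the first row of the result is the first
column of `M` read from bottom to top. -/
def rotate90 {n : ℕ} {R : Type*} (M : Matrix (Fin n) (Fin n) R) : Matrix (Fin n) (Fin n) R :=
  Matrix.of fun i j => M j.rev i

/-- The Baxter permutations of length `n` whose permutation matrix is fixed under rotation by
90 degrees. -/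
def quarterTurnBaxter (n : ℕ) : Set (Equiv.Perm (Fin n)) :=
  {w | IsBaxter w ∧ rotate90 (w.permMatrix ℤ) = w.permMatrix ℤ}

/-! ### The Catalan generating tree -/

/-- The number of nodes at depth `d` below a node labelled `k` in the generating tree in which a
node labelled `k` has children labelled `2, …, k + 1`. -/
def treeCount : ℕ → ℕ → ℕ
  | 0, _ => 1
  | d + 1, k => ∑ l ∈ Finset.range k, treeCount d (l + 2)

/-- Ballot numbers: a difference of two neighbouring binomials, written additively to avoid
truncated subtraction. The last child of a node labelled `k + 1` has label `k + 2`, which matches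
Pascal's rule. -/
theorem treeCount_succ_add_choose (d k : ℕ) :
    treeCount (d + 1) k + (2 * d + 1 + k).choose d = (2 * d + 1 + k).choose (d + 1) := by
  induction d generalizing k with
  | zero => simp [treeCount]; omega
  | succ d ihd =>
    induction k with
    | zero =>
      -- A node labelled 0 has no children, and the two middle binomials of an odd row agree.
      have := Nat.choose_symm_half (d + 1)
      simp only [treeCount, Finset.range_zero, Finset.sum_empty]
      simpa using this.symm
    | succ k ihk =>
      have h := ihd (k + 2)
      have hs : treeCount (d + 1 + 1) (k + 1) =
          treeCount (d + 1 + 1) k + treeCount (d + 1) (k + 2) :=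
        Finset.sum_range_succ _ _
      have e : 2 * (d + 1) + 1 + (k + 1) = (2 * (d + 1) + 1 + k) + 1 := by ring
      have e' : 2 * d + 1 + (k + 2) = 2 * (d + 1) + 1 + k := by ring
      rw [e'] at h
      rw [hs, e, Nat.choose_succ_succ, Nat.choose_succ_succ]
      simp only [Nat.succ_eq_add_one] at *
      omega

theorem treeCount_one (d : ℕ) : treeCount d 1 = catalan d := by
  cases d with
  | zero => simp [treeCount]
  | succ d =>
    have h := treeCount_succ_add_choose d 1
    have hc := succ_mul_catalan_eq_centralBinom (d + 1)
    have hr := Nat.choose_succ_right_eq (2 * d + 1 + 1) d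
    rw [Nat.centralBinom_eq_two_mul_choose] at hc
    have e : 2 * (d + 1) = 2 * d + 1 + 1 := by ring
    have e' : 2 * d + 1 + 1 - d = d + 2 := by omega
    rw [e] at hc
    rw [e'] at hr
    have : (d + 2) * treeCount (d + 1) 1 = (d + 2) * catalan (d + 1) := by
      nlinarith
    exact Nat.eq_of_mul_eq_mul_left (by omega) this

/-- Ranking the elements of a finset `A` matches them with `0, …, #A - 1`. -/
theorem Finset.sum_rank {α M : Type*} [LinearOrder α] [AddCommMonoid M] (A : Finset α)
    (g : ℕ → M) :
    ∑ q ∈ A, g (A.filter (· < q)).card = ∑ l ∈ Finset.range A.card, g l := by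
  induction A using Finset.induction_on_max with
  | empty => simp
  | insert a A ha ih =>
    have hn : a ∉ A := fun h => lt_irrefl _ (ha a h)
    rw [Finset.sum_insert hn, Finset.card_insert_of_notMem hn, Finset.sum_range_succ, ← ih,
      add_comm]
    congr 1
    · refine Finset.sum_congr rfl fun q hq => ?_
      rw [Finset.filter_insert, if_neg (ha q hq).not_gt]
    · rw [Finset.filter_insert, if_neg (lt_irrefl a), Finset.filter_true_of_mem ha]

/-! ### Quarter-turn symmetry and mirror images -/

/-- Quarter-turn symmetry of the permutation matrix: the square of `w` is the reversal. -/
def IsQuarterTurn {n : ℕ} (w : Equiv.Perm (Fin n)) : Prop :=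
  ∀ x, w (w x) = x.rev

theorem rotate90_permMatrix_eq_iff {n : ℕ} (w : Equiv.Perm (Fin n)) :
    rotate90 (w.permMatrix ℤ) = w.permMatrix ℤ ↔ IsQuarterTurn w := by
  have key : rotate90 (w.permMatrix ℤ) = w.permMatrix ℤ ↔ ∀ i j, (w j.rev = i ↔ w i = j) := by
    rw [← Matrix.ext_iff]
    refine forall₂_congr fun i j => ?_
    simp only [rotate90, Matrix.of_apply, Equiv.Perm.permMatrix, PEquiv.toMatrix_apply,
      Equiv.toPEquiv_apply, Option.mem_def, Option.some.injEq]
    by_cases h1 : w j.rev = i <;> by_cases h2 : w i = j <;> simp [h1, h2]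
  rw [key]
  constructor
  · intro h x
    exact (h (w x) x.rev).1 (by simp)
  · intro h i j
    constructor
    · rintro rfl
      rw [h, Fin.rev_rev]
    · rintro rfl
      rw [← h, h, h, Fin.rev_rev]

namespace IsQuarterTurn

variable {n : ℕ} {w : Equiv.Perm (Fin n)}

theorem apply_rev (h : IsQuarterTurn w) (x : Fin n) : w x.rev = (w x).rev := by
  rw [← h x, h (w x)]

/-- The inverse of `w` is its cube. So `(x, w x) ↦ ((w x).rev, x)` rotates the graph of `w` onto
itself. -/
theorem apply_rev_apply (h : IsQuarterTurn w) (x : Fin n) : w (w x).rev = x := by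
  rw [h.apply_rev, h, Fin.rev_rev]

end IsQuarterTurn

/-- The permutation with a given underlying map whose square is the reversal. -/
def permOfSqEqRev {n : ℕ} (f : Fin n → Fin n) (h : ∀ x, f (f x) = x.rev) :
    Equiv.Perm (Fin n) where
  toFun := f
  invFun x := (f x).rev
  left_inv x := by simp [h]
  right_inv x := by
    have : f (f x).rev = (f (f x)).rev := by rw [← h (f x), h (f (f x))]
    simp [this, h]

/-- The mirror image of a permutation. -/
def mirror {n : ℕ} (w : Equiv.Perm (Fin n)) : Equiv.Perm (Fin n) := w.trans Fin.revPerm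

theorem mirror_apply {n : ℕ} (w : Equiv.Perm (Fin n)) (x : Fin n) : mirror w x = (w x).rev := rfl

theorem mirror_mirror {n : ℕ} (w : Equiv.Perm (Fin n)) : mirror (mirror w) = w := by
  ext x; simp [mirror_apply]

theorem IsQuarterTurn.mirror {n : ℕ} {w : Equiv.Perm (Fin n)} (h : IsQuarterTurn w) :
    IsQuarterTurn (mirror w) := by
  intro x
  rw [mirror_apply, mirror_apply, h.apply_rev, h, Fin.rev_rev]

theorem IsBaxter.mirror {n : ℕ} {w : Equiv.Perm (Fin n)} (h : IsBaxter w) :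
    IsBaxter (mirror w) := by
  constructor
  · rintro ⟨i, j, j', k, h1, h2, h3, h4, h5, h6⟩
    simp only [mirror_apply, Fin.rev_lt_rev] at h4 h5 h6
    exact h.2 ⟨i, j, j', k, h1, h2, h3, h6, h5, h4⟩
  · rintro ⟨i, j, j', k, h1, h2, h3, h4, h5, h6⟩
    simp only [mirror_apply, Fin.rev_lt_rev] at h4 h5 h6
    exact h.1 ⟨i, j, j', k, h1, h2, h3, h6, h5, h4⟩

/-! ### Left-to-right maxima -/

/-- The positions of the left-to-right maxima of `w`. -/
def leftMaxima {n : ℕ} (w : Equiv.Perm (Fin n)) : Finset (Fin n) :=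
  Finset.univ.filter fun q => ∀ i < q, w i < w q

theorem mem_leftMaxima {n : ℕ} {w : Equiv.Perm (Fin n)} {q : Fin n} :
    q ∈ leftMaxima w ↔ ∀ i < q, w i < w q := by
  simp [leftMaxima]

namespace IsQuarterTurn

variable {n : ℕ} {w : Equiv.Perm (Fin n)}

/-- Every left-to-right maximum lies above every left-to-right minimum. -/
theorem le_apply_of_mem_leftMaxima (h : IsQuarterTurn w) {q y : Fin n} (hq : q ∈ leftMaxima w)
    (hy : y ∈ leftMaxima w) : q ≤ w y := by
  rw [mem_leftMaxima] at hq hy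
  by_contra! hlt
  -- If `w y < q`, the maximum at `q` gives `y.rev < w q`, so `(w q).rev < y`; the maximum at `y`
  -- then gives `q < w y`.
  have h1 := hq _ hlt
  rw [h] at h1
  have h2 := hy (w q).rev (by rw [Fin.lt_def, Fin.val_rev] at *; omega)
  rw [h.apply_rev_apply] at h2
  exact lt_asymm h2 hlt

/-- Left-to-right maxima of the mirror image are left-to-right minima of `w`. A quarter turn carries
the upper left quadrant of a point to the lower left one, hence maxima to minima. -/
theorem card_leftMaxima_mirror (h : IsQuarterTurn w) :
    (leftMaxima (_root_.mirror w)).card = (leftMaxima w).card := by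
  symm
  refine Finset.card_bij (fun q _ => (w q).rev) ?_ ?_ ?_
  · intro q hq
    rw [mem_leftMaxima] at hq ⊢
    intro i hi
    rw [mirror_apply, mirror_apply, Fin.rev_lt_rev, h.apply_rev_apply]
    by_contra! hle
    rcases hle.lt_or_eq with hlt | heq
    · have := hq _ hlt
      rw [h, Fin.lt_def, Fin.val_rev] at this
      rw [Fin.lt_def, Fin.val_rev] at hi
      omega
    · rw [← heq, h, Fin.rev_rev] at hi
      exact lt_irrefl _ hi
  · intro a _ b _ hab
    exact w.injective (Fin.rev_injective hab)
  · intro b hb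
    refine ⟨w b, ?_, by rw [h, Fin.rev_rev]⟩
    rw [mem_leftMaxima] at hb ⊢
    intro i hi
    rw [h]
    by_contra! hle
    rcases hle.lt_or_eq with hlt | heq
    · have := hb (w i).rev (by rw [Fin.lt_def, Fin.val_rev] at *; omega)
      rw [mirror_apply, mirror_apply, Fin.rev_lt_rev, h.apply_rev_apply] at this
      exact lt_asymm this hi
    · rw [← h] at heq
      exact hi.ne (w.injective heq.symm)

end IsQuarterTurn

/-! ### Making the middle of a pattern adjacent -/

/-- If the entries strictly between positions `a < b` are each below `w k` or above `w i`, an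
occurrence of 3-1-4-2 at `i, a, b, k` yields one with the middle two entries adjacent. -/
theorem contains3142_of_between {n : ℕ} {w : Equiv.Perm (Fin n)} {i a b k : Fin n} (hia : i < a)
    (hab : a < b) (hbk : b < k) (ha : w a < w k) (hki : w k < w i) (hb : w i < w b)
    (hc : ∀ c, a < c → c < b → w c < w k ∨ w i < w c) : Contains3142 w := by
  obtain ⟨d, hd⟩ : ∃ d, (b : ℕ) = a + 1 + d := ⟨b - a - 1, by rw [Fin.lt_def] at hab; omega⟩
  induction d generalizing a with
  | zero => exact ⟨i, a, b, k, hia, hd, hbk, ha, hki, hb⟩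
  | succ d ih =>
    have hb' := b.isLt
    let c : Fin n := ⟨a + 1, by omega⟩
    have hac : a < c := by simp [c, Fin.lt_def]
    have hcb : c < b := by simp [c, Fin.lt_def]; omega
    -- A low entry right after `a` replaces `a`; a high one completes the pattern.
    rcases hc c hac hcb with h | h
    · exact ih (hia.trans hac) hcb h (fun x hx => hc x (hac.trans hx)) (by simp [c]; omega)
    · exact ⟨i, a, c, k, hia, rfl, hcb.trans hbk, ha, hki, h⟩

/-- If the entries strictly between positions `a < b` are each above `w k` or below `w i`, an
occurrence of 2-4-1-3 at `i, a, b, k` yields one with the middle two entries adjacent. -/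
theorem contains2413_of_between {n : ℕ} {w : Equiv.Perm (Fin n)} {i a b k : Fin n} (hia : i < a)
    (hab : a < b) (hbk : b < k) (ha : w k < w a) (hik : w i < w k) (hb : w b < w i)
    (hc : ∀ c, a < c → c < b → w k < w c ∨ w c < w i) : Contains2413 w := by
  obtain ⟨d, hd⟩ : ∃ d, (b : ℕ) = a + 1 + d := ⟨b - a - 1, by rw [Fin.lt_def] at hab; omega⟩
  induction d generalizing a with
  | zero => exact ⟨i, a, b, k, hia, hd, hbk, hb, hik, ha⟩
  | succ d ih =>
    have hb' := b.isLt
    let c : Fin n := ⟨a + 1, by omega⟩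
    have hac : a < c := by simp [c, Fin.lt_def]
    have hcb : c < b := by simp [c, Fin.lt_def]; omega
    rcases hc c hac hcb with h | h
    · exact ih (hia.trans hac) hcb h (fun x hx => hc x (hac.trans hx)) (by simp [c]; omega)
    · exact ⟨i, a, c, k, hia, rfl, hcb.trans hbk, h, hik, ha⟩

/-! ### Deleting and inserting the outer orbit -/

/-- `p` is a position at which the maximal entry of a quarter-turn symmetric permutation of
length `n + 4` can stand. -/
def IsOuterPosition {n : ℕ} (p : Fin (n + 4)) : Prop :=
  0 < (p : ℕ) ∧ (p : ℕ) < n + 3 ∧ 2 * (p : ℕ) ≠ n + 3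

/-- The increasing map from `Fin n` to `Fin (n + 4)` which skips `0`, `p`, `p.rev` and the last
element. -/
def innerEmb {n : ℕ} (p : Fin (n + 4)) (y : Fin n) : Fin (n + 4) :=
  ⟨if (y : ℕ) + 1 < min (p : ℕ) (n + 3 - p) then y + 1 else
    if (y : ℕ) + 2 < max (p : ℕ) (n + 3 - p) then y + 2 else y + 3, by split_ifs <;> omega⟩

theorem innerEmb_val {n : ℕ} (p : Fin (n + 4)) (y : Fin n) : (innerEmb p y : ℕ) =
    if (y : ℕ) + 1 < min (p : ℕ) (n + 3 - p) then (y : ℕ) + 1 else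
    if (y : ℕ) + 2 < max (p : ℕ) (n + 3 - p) then (y : ℕ) + 2 else (y : ℕ) + 3 := rfl

theorem innerEmb_strictMono {n : ℕ} (p : Fin (n + 4)) : StrictMono (innerEmb p) := by
  intro x y hxy
  rw [Fin.lt_def] at hxy ⊢
  rw [innerEmb_val, innerEmb_val]
  split_ifs <;> omega

namespace IsOuterPosition

variable {n : ℕ} {p : Fin (n + 4)}

theorem innerEmb_rev (hp : IsOuterPosition p) (y : Fin n) :
    innerEmb p y.rev = (innerEmb p y).rev := by
  obtain ⟨h1, h2, h3⟩ := hp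
  rw [Fin.ext_iff, Fin.val_rev, innerEmb_val, innerEmb_val, Fin.val_rev]
  split_ifs <;> omega

theorem innerEmb_ne (hp : IsOuterPosition p) (y : Fin n) :
    (innerEmb p y : ℕ) ≠ 0 ∧ (innerEmb p y : ℕ) ≠ p ∧ (innerEmb p y : ℕ) ≠ n + 3 - p ∧
      (innerEmb p y : ℕ) ≠ n + 3 := by
  obtain ⟨h1, h2, h3⟩ := hp
  rw [innerEmb_val]
  split_ifs <;> omega

theorem exists_innerEmb_eq (hp : IsOuterPosition p) {x : Fin (n + 4)} (h0 : (x : ℕ) ≠ 0)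
    (hxp : (x : ℕ) ≠ p) (hxp' : (x : ℕ) ≠ n + 3 - p) (hl : (x : ℕ) ≠ n + 3) :
    ∃ y, innerEmb p y = x := by
  obtain ⟨h1, h2, h3⟩ := hp
  have hx := x.isLt
  refine ⟨⟨if (x : ℕ) < min (p : ℕ) (n + 3 - p) then x - 1 else
    if (x : ℕ) < max (p : ℕ) (n + 3 - p) then x - 2 else x - 3, by split_ifs <;> omega⟩, ?_⟩
  rw [Fin.ext_iff, innerEmb_val]
  dsimp only
  split_ifs <;> omega

end IsOuterPosition

namespace IsQuarterTurn

variable {n : ℕ} {w : Equiv.Perm (Fin (n + 4))}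

theorem apply_apply_zero (h : IsQuarterTurn w) : w (w 0) = Fin.last (n + 3) := by
  rw [h, Fin.rev_zero]

theorem apply_last (h : IsQuarterTurn w) : w (Fin.last (n + 3)) = (w 0).rev := by
  rw [← h.apply_apply_zero, h]

theorem apply_rev_apply_zero (h : IsQuarterTurn w) : w (w 0).rev = 0 :=
  h.apply_rev_apply 0

theorem isOuterPosition (h : IsQuarterTurn w) : IsOuterPosition (w 0) := by
  have h1 := h.apply_apply_zero
  have h2 := h.apply_last
  have h3 := h.apply_rev_apply_zero
  refine ⟨?_, ?_, ?_⟩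
  · by_contra h0
    have : w 0 = 0 := by rw [Fin.ext_iff, Fin.val_zero]; omega
    rw [this, this, Fin.ext_iff] at h1
    simp at h1
  · by_contra h0
    have : w 0 = Fin.last (n + 3) := by rw [Fin.ext_iff, Fin.val_last]; omega
    rw [this, h2, this, Fin.ext_iff] at h1
    simp at h1
  · intro h0
    have : (w 0).rev = w 0 := by rw [Fin.ext_iff, Fin.val_rev]; omega
    rw [this, h1, Fin.ext_iff] at h3
    simp at h3

end IsQuarterTurn

/-- `v` is obtained from `w` by deleting the orbit of `0`, i.e. the four outermost points of the
permutation matrix. -/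
def IsInner {n : ℕ} (w : Equiv.Perm (Fin (n + 4))) (v : Equiv.Perm (Fin n)) : Prop :=
  ∀ y, w (innerEmb (w 0) y) = innerEmb (w 0) (v y)

/-- The complement of an orbit is invariant under `w`, and `innerEmb` commutes with reversal. -/
theorem IsQuarterTurn.exists_isInner {n : ℕ} {w : Equiv.Perm (Fin (n + 4))}
    (h : IsQuarterTurn w) : ∃ v, IsQuarterTurn v ∧ IsInner w v := by
  have hp := h.isOuterPosition
  have key : ∀ y : Fin n, ∃ z, w (innerEmb (w 0) y) = innerEmb (w 0) z := by
    intro y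
    obtain ⟨n1, n2, n3, n4⟩ := hp.innerEmb_ne y
    obtain ⟨z, hz⟩ := hp.exists_innerEmb_eq (x := w (innerEmb (w 0) y))
      (fun e => n3 (by
        have : w (innerEmb (w 0) y) = w (w 0).rev := by
          rw [h.apply_rev_apply_zero]; exact Fin.ext e
        rw [w.injective this, Fin.val_rev]; omega))
      (fun e => n1 (by
        have := w.injective (Fin.ext e)
        rw [this]; rfl))
      (fun e => n4 (by
        have : w (innerEmb (w 0) y) = w (Fin.last (n + 3)) := by
          rw [h.apply_last, Fin.ext_iff, e, Fin.val_rev]; omega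
        rw [w.injective this, Fin.val_last]))
      (fun e => n2 (by
        have : w (innerEmb (w 0) y) = w (w 0) := by
          rw [h.apply_apply_zero]; exact Fin.ext e
        rw [w.injective this]))
    exact ⟨z, hz.symm⟩
  choose f hf using key
  have hff : ∀ y, f (f y) = y.rev := by
    intro y
    apply (innerEmb_strictMono (w 0)).injective
    rw [← hf, ← hf, h, hp.innerEmb_rev]
  exact ⟨permOfSqEqRev f hff, hff, hf⟩

/-- Any quarter-turn symmetric permutation extends by an orbit at any outer position. -/
theorem IsQuarterTurn.exists_extension {n : ℕ} {v : Equiv.Perm (Fin n)} (h : IsQuarterTurn v)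
    {p : Fin (n + 4)} (hp : IsOuterPosition p) :
    ∃ w, IsQuarterTurn w ∧ w 0 = p ∧ IsInner w v := by
  let g : Fin (n + 4) → Fin (n + 4) := fun x =>
    if x = 0 then p else if x = p then Fin.last (n + 3) else
      if x = Fin.last (n + 3) then p.rev else 0
  let f := Function.extend (innerEmb p) (innerEmb p ∘ v) g
  have hf : ∀ y, f (innerEmb p y) = innerEmb p (v y) := fun y =>
    (innerEmb_strictMono p).injective.extend_apply _ _ _
  have hne : ∀ x : Fin (n + 4), ((x : ℕ) = 0 ∨ (x : ℕ) = p ∨ (x : ℕ) = n + 3 - p ∨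
      (x : ℕ) = n + 3) → f x = g x := by
    intro x hx
    refine Function.extend_apply' _ _ _ ?_
    rintro ⟨y, rfl⟩
    have := hp.innerEmb_ne y
    omega
  obtain ⟨p1, p2, p3⟩ := id hp
  have f0 : f 0 = p := by rw [hne 0 (by simp)]; simp [g]
  have fp : f p = Fin.last (n + 3) := by
    rw [hne p (by simp)]
    have : p ≠ 0 := by intro e; simp [e] at p1
    simp [g, this]
  have fl : f (Fin.last (n + 3)) = p.rev := by
    rw [hne _ (by simp)]
    have : Fin.last (n + 3) ≠ p := by intro e; simp [← e] at p2
    have h0 : Fin.last (n + 3) ≠ 0 := by rw [Ne, Fin.ext_iff]; simp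
    simp [g, this, h0]
  have fr : f p.rev = 0 := by
    rw [hne _ (by rw [Fin.val_rev]; omega)]
    have h0 : p.rev ≠ 0 := by rw [Ne, Fin.ext_iff, Fin.val_rev, Fin.val_zero]; omega
    have h1 : p.rev ≠ p := by rw [Ne, Fin.ext_iff, Fin.val_rev]; omega
    have h2 : p.rev ≠ Fin.last (n + 3) := by
      rw [Ne, Fin.ext_iff, Fin.val_rev, Fin.val_last]; omega
    simp only [g, if_neg h0, if_neg h1, if_neg h2]
  have hff : ∀ x, f (f x) = x.rev := by
    intro x
    by_cases h0 : (x : ℕ) = 0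
    · have : x = 0 := Fin.ext h0
      rw [this, f0, fp, Fin.rev_zero]
    by_cases h1 : (x : ℕ) = p
    · rw [Fin.ext h1, fp, fl]
    by_cases h2 : (x : ℕ) = n + 3 - p
    · have : x = p.rev := by rw [Fin.ext_iff, Fin.val_rev]; omega
      rw [this, fr, f0, Fin.rev_rev]
    by_cases h3 : (x : ℕ) = n + 3
    · have : x = Fin.last (n + 3) := Fin.ext h3
      rw [this, fl, fr, Fin.rev_last]
    obtain ⟨y, rfl⟩ := hp.exists_innerEmb_eq h0 h1 h2 h3
    rw [hf, hf, h, hp.innerEmb_rev]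
  refine ⟨permOfSqEqRev f hff, hff, f0, ?_⟩
  intro y
  change f (innerEmb (f 0) y) = innerEmb (f 0) (v y)
  rw [f0, hf]

/-- A quarter-turn symmetric permutation is determined by its first entry and its inner part. -/
theorem IsInner.ext {n : ℕ} {w w' : Equiv.Perm (Fin (n + 4))} {v : Equiv.Perm (Fin n)}
    (hv : IsInner w v) (hv' : IsInner w' v) (h : IsQuarterTurn w) (h' : IsQuarterTurn w')
    (h0 : w 0 = w' 0) : w = w' := by
  ext1 x
  by_cases x0 : (x : ℕ) = 0
  · have : x = 0 := Fin.ext x0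
    rw [this, h0]
  by_cases x1 : (x : ℕ) = w 0
  · rw [Fin.ext x1, h.apply_apply_zero, h0, h'.apply_apply_zero]
  by_cases x2 : (x : ℕ) = n + 3 - w 0
  · have : x = (w 0).rev := by rw [Fin.ext_iff, Fin.val_rev]; omega
    rw [this, h.apply_rev_apply_zero, h0, h'.apply_rev_apply_zero]
  by_cases x3 : (x : ℕ) = n + 3
  · have : x = Fin.last (n + 3) := Fin.ext x3
    rw [this, h.apply_last, h'.apply_last, h0]
  obtain ⟨y, rfl⟩ := h.isOuterPosition.exists_innerEmb_eq x0 x1 x2 x3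
  rw [hv, h0, hv']

theorem IsInner.unique {n : ℕ} {w : Equiv.Perm (Fin (n + 4))} {v v' : Equiv.Perm (Fin n)}
    (hv : IsInner w v) (hv' : IsInner w v') : v = v' := by
  ext1 y
  exact (innerEmb_strictMono (w 0)).injective (by rw [← hv, ← hv'])

theorem IsInner.lt_iff {n : ℕ} {w : Equiv.Perm (Fin (n + 4))} {v : Equiv.Perm (Fin n)}
    (hv : IsInner w v) {x y : Fin n} :
    w (innerEmb (w 0) x) < w (innerEmb (w 0) y) ↔ v x < v y := by
  rw [hv, hv, (innerEmb_strictMono _).lt_iff_lt]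

theorem IsQuarterTurn.eq_or_eq_of_innerEmb_lt {n : ℕ} {w : Equiv.Perm (Fin (n + 4))}
    (h : IsQuarterTurn w) {j j' : Fin n} (hj : (j' : ℕ) = j + 1) {c : Fin (n + 4)}
    (h1 : innerEmb (w 0) j < c) (h2 : c < innerEmb (w 0) j') : c = w 0 ∨ c = (w 0).rev := by
  have hp := h.isOuterPosition
  by_contra! hc
  rw [Ne, Fin.ext_iff, Ne, Fin.ext_iff, Fin.val_rev] at hc
  rw [Fin.lt_def] at h1 h2
  obtain ⟨y, rfl⟩ := hp.exists_innerEmb_eq (x := c) (by omega) hc.1 (by omega) (by omega)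
  rw [← Fin.lt_def, (innerEmb_strictMono _).lt_iff_lt, Fin.lt_def] at h1 h2
  omega

/-- A pattern in `v` lifts to `w` with its middle positions separated at most by the columns of the
extreme entries. These are harmless for `contains3142_of_between` and `contains2413_of_between`. -/
theorem IsBaxter.of_isInner {n : ℕ} {w : Equiv.Perm (Fin (n + 4))} {v : Equiv.Perm (Fin n)}
    (hb : IsBaxter w) (h : IsQuarterTurn w) (hv : IsInner w v) : IsBaxter v := by
  have hm := innerEmb_strictMono (w 0)
  have top : ∀ y : Fin n, w (innerEmb (w 0) y) < w (w 0) := by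
    intro y
    have := (h.isOuterPosition.innerEmb_ne (v y)).2.2.2
    rw [hv, h.apply_apply_zero, Fin.lt_def, Fin.val_last]
    omega
  have bot : ∀ y : Fin n, w (w 0).rev < w (innerEmb (w 0) y) := by
    intro y
    have := (h.isOuterPosition.innerEmb_ne (v y)).1
    rw [hv, h.apply_rev_apply_zero, Fin.lt_def, Fin.val_zero]
    omega
  constructor
  · rintro ⟨i, j, j', k, h1, h2, h3, h4, h5, h6⟩
    refine hb.1 (contains3142_of_between (hm h1) (hm (Fin.lt_def.2 (by omega))) (hm h3)
      (hv.lt_iff.2 h4) (hv.lt_iff.2 h5) (hv.lt_iff.2 h6) fun c hc hc' => ?_)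
    rcases h.eq_or_eq_of_innerEmb_lt h2 hc hc' with rfl | rfl
    · exact Or.inr (top i)
    · exact Or.inl (bot k)
  · rintro ⟨i, j, j', k, h1, h2, h3, h4, h5, h6⟩
    refine hb.2 (contains2413_of_between (hm h1) (hm (Fin.lt_def.2 (by omega))) (hm h3)
      (hv.lt_iff.2 h6) (hv.lt_iff.2 h5) (hv.lt_iff.2 h4) fun c hc hc' => ?_)
    rcases h.eq_or_eq_of_innerEmb_lt h2 hc hc' with rfl | rfl
    · exact Or.inl (top k)
    · exact Or.inr (bot i)

/-! ### The site next to the maximal entry -/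

/-- The entry at `s`, immediately to the right of the maximal entry, exceeds all entries to the
left of the maximal one. -/
def IsLeftSite {n : ℕ} (w : Equiv.Perm (Fin (n + 4))) (s : Fin (n + 4)) : Prop :=
  (s : ℕ) = w 0 + 1 ∧ ∀ i < w 0, w i < w s

/-- The second largest entry stands at `w 1`, to the right of the maximum. An entry before the
maximum exceeding the one at `s` would form 2-41-3 with positions `w 0`, `s`, `w 1`. -/
theorem IsBaxter.exists_isLeftSite {n : ℕ} {w : Equiv.Perm (Fin (n + 4))} (hb : IsBaxter w)
    (h : IsQuarterTurn w) (h01 : w 0 < w 1) : ∃ s, IsLeftSite w s := by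
  have hp := h.isOuterPosition
  have h1 : ((w (w 1) : Fin (n + 4)) : ℕ) = n + 2 := by
    rw [h, Fin.val_rev]; simp
  refine ⟨⟨w 0 + 1, by have := hp.2.1; omega⟩, rfl, fun i hi => ?_⟩
  set s : Fin (n + 4) := ⟨w 0 + 1, _⟩ with hs
  have hsv : (s : ℕ) = w 0 + 1 := rfl
  by_contra! hle
  have hne : w i ≠ w s := fun e => by
    have := w.injective e
    rw [this, Fin.lt_def] at hi; omega
  have hlt : w s < w i := lt_of_le_of_ne hle hne.symm
  have hip : w i ≠ w (w 0) := fun e => hi.ne (w.injective e)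
  have hi1 : w i ≠ w (w 1) := fun e => by
    rw [w.injective e] at hi; exact lt_asymm hi h01
  have hl := h.apply_apply_zero
  rw [hl, Ne, Fin.ext_iff, Fin.val_last] at hip
  rw [Ne, Fin.ext_iff, h1] at hi1
  have hs1 : s ≠ w 1 := fun e => by
    rw [e, Fin.lt_def, h1] at hlt; omega
  refine hb.2 ⟨i, w 0, s, w 1, hi, rfl, ?_, hlt, ?_, ?_⟩
  · rw [Ne, Fin.ext_iff] at hs1
    rw [Fin.lt_def] at h01 ⊢
    omega
  · rw [Fin.lt_def, h1]; omega
  · rw [Fin.lt_def, h1, hl, Fin.val_last]; omega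

namespace IsLeftSite

variable {n : ℕ} {w : Equiv.Perm (Fin (n + 4))} {s : Fin (n + 4)}

theorem apply_zero_lt_apply_one (hs : IsLeftSite w s) (h : IsQuarterTurn w) : w 0 < w 1 := by
  have h1 : ((w (w 1) : Fin (n + 4)) : ℕ) = n + 2 := by
    rw [h, Fin.val_rev]; simp
  have hl := h.apply_apply_zero
  by_contra! hle
  have hne : w 1 ≠ w 0 := fun e => by
    have := w.injective e
    rw [Fin.ext_iff] at this; simp at this
  have h2 := hs.2 _ (lt_of_le_of_ne hle hne)
  rw [Fin.lt_def, h1] at h2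
  have : w s = w (w 0) := by rw [hl, Fin.ext_iff, Fin.val_last]; omega
  have h3 := hs.1
  rw [w.injective this] at h3
  omega

theorem apply_zero_lt (hs : IsLeftSite w s) (h : IsQuarterTurn w) : w 0 < w s :=
  hs.2 0 (Fin.lt_def.2 h.isOuterPosition.1)

/-- The site is an inner position. -/
theorem exists_innerEmb_eq (hs : IsLeftSite w s) (h : IsQuarterTurn w) :
    ∃ q, innerEmb (w 0) q = s := by
  have hp := h.isOuterPosition
  have h0 := hs.apply_zero_lt h
  have h1 := hs.1
  obtain ⟨p1, p2, p3⟩ := id hp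
  refine hp.exists_innerEmb_eq (by omega) (by omega) (fun e => ?_) (fun e => ?_)
  · have : s = (w 0).rev := by rw [Fin.ext_iff, Fin.val_rev]; omega
    rw [this, h.apply_rev_apply_zero] at h0
    exact Nat.not_lt_zero _ (Fin.lt_def.1 h0)
  · have : s = Fin.last (n + 3) := Fin.ext e
    rw [this, h.apply_last, Fin.lt_def, Fin.val_rev] at h0
    omega

/-- This and the next two lemmas are rotated forms of the site condition. -/
theorem lt_apply (hs : IsLeftSite w s) (h : IsQuarterTurn w) {x : Fin (n + 4)} (hx : x ≠ 0)
    (hxs : x < (w s).rev) : s < w x := by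
  have hne : w x ≠ w 0 := fun e => hx (w.injective e)
  have h1 := hs.1
  by_contra! hle
  have h2 : w (w x) ≤ w s := by
    rcases hle.eq_or_lt with e | e
    · rw [e]
    · refine (hs.2 _ ?_).le
      rw [Ne, Fin.ext_iff] at hne
      rw [Fin.lt_def] at e ⊢
      omega
  rw [h, Fin.le_def, Fin.val_rev] at h2
  rw [Fin.lt_def, Fin.val_rev] at hxs
  omega

theorem apply_lt_rev (hs : IsLeftSite w s) (h : IsQuarterTurn w) {x : Fin (n + 4)}
    (hx : x ≠ Fin.last (n + 3)) (hxs : w s < x) : w x < s.rev := by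
  have := hs.lt_apply h (x := x.rev) (fun e => hx (by rw [← Fin.rev_rev x, e, Fin.rev_zero]))
    (Fin.rev_lt_rev.2 hxs)
  rw [h.apply_rev] at this
  rwa [← Fin.rev_lt_rev, Fin.rev_rev]

theorem apply_rev_lt (hs : IsLeftSite w s) (h : IsQuarterTurn w) {x : Fin (n + 4)}
    (hx : (w 0).rev < x) : w s.rev < w x := by
  have := hs.2 x.rev (by rwa [← Fin.rev_lt_rev, Fin.rev_rev])
  rwa [h.apply_rev, ← Fin.rev_lt_rev, Fin.rev_rev, ← h.apply_rev] at this

theorem mem_leftMaxima {v : Equiv.Perm (Fin n)} {q : Fin n} (hv : IsInner w v)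
    (h : IsQuarterTurn w) (hs : IsLeftSite w (innerEmb (w 0) q)) : q ∈ leftMaxima v := by
  rw [_root_.mem_leftMaxima]
  intro i hi
  have h1 := innerEmb_strictMono (w 0) hi
  have h2 := (h.isOuterPosition.innerEmb_ne i).2.1
  have h3 := hs.1
  rw [← hv.lt_iff]
  refine hs.2 _ ?_
  rw [Fin.lt_def] at h1 ⊢
  omega

end IsLeftSite

theorem IsInner.lt_innerEmb_of_mem_leftMaxima {n : ℕ} {w : Equiv.Perm (Fin (n + 4))}
    {v : Equiv.Perm (Fin n)} (hv : IsInner w v) (h' : IsQuarterTurn v)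
    {q y : Fin n} (hq : q ∈ leftMaxima v) (hy : y ∈ leftMaxima v)
    (hs : (innerEmb (w 0) q : ℕ) = w 0 + 1) : w 0 < w (innerEmb (w 0) y) := by
  have := (innerEmb_strictMono (w 0)).monotone (h'.le_apply_of_mem_leftMaxima hq hy)
  rw [hv]
  rw [Fin.le_def] at this
  rw [Fin.lt_def]
  omega

/-- Before the maximum stand the first entry, possibly the minimum, and inner entries before `q`.
The first entry is low enough because left-to-right maxima of `v` have values at least `q`. -/
theorem IsInner.isLeftSite {n : ℕ} {w : Equiv.Perm (Fin (n + 4))}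
    {v : Equiv.Perm (Fin n)} (hv : IsInner w v) (h : IsQuarterTurn w) (h' : IsQuarterTurn v)
    {q : Fin n} (hq : q ∈ leftMaxima v) (hs : (innerEmb (w 0) q : ℕ) = w 0 + 1) :
    IsLeftSite w (innerEmb (w 0) q) := by
  refine ⟨hs, fun i hi => ?_⟩
  have hp := h.isOuterPosition
  have h0 := hv.lt_innerEmb_of_mem_leftMaxima h' hq hq hs
  rw [Fin.lt_def] at hi
  by_cases i0 : (i : ℕ) = 0
  · have : i = 0 := Fin.ext i0
    rwa [this]
  by_cases i1 : (i : ℕ) = n + 3 - w 0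
  · have : i = (w 0).rev := by rw [Fin.ext_iff, Fin.val_rev]; omega
    rw [this, h.apply_rev_apply_zero]
    exact lt_of_le_of_lt (Fin.zero_le _) h0
  obtain ⟨y, rfl⟩ := hp.exists_innerEmb_eq i0 (by omega) i1 (by have := hp.2.1; omega)
  rw [hv.lt_iff]
  refine mem_leftMaxima.1 hq _ ?_
  rw [← (innerEmb_strictMono (w 0)).lt_iff_lt, Fin.lt_def]
  omega

/-- No left-to-right maximum follows the maximal entry, and the new first entry lies below every
inner one. So the survivors are those before `q`, joined by the first and the maximal entry. -/
theorem IsInner.card_leftMaxima {n : ℕ} {w : Equiv.Perm (Fin (n + 4))}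
    {v : Equiv.Perm (Fin n)} (hv : IsInner w v) (h : IsQuarterTurn w) (h' : IsQuarterTurn v)
    {q : Fin n} (hs : IsLeftSite w (innerEmb (w 0) q)) :
    (leftMaxima w).card = ((leftMaxima v).filter (· < q)).card + 2 := by
  have hp := h.isOuterPosition
  have hq := hs.mem_leftMaxima hv h
  have hm := innerEmb_strictMono (w 0)
  have key : leftMaxima w = insert 0 (insert (w 0)
      (((leftMaxima v).filter (· < q)).image (innerEmb (w 0)))) := by
    ext x
    simp only [Finset.mem_insert, Finset.mem_image, Finset.mem_filter]
    constructor
    · intro hx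
      rw [mem_leftMaxima] at hx
      by_cases x0 : x = 0
      · exact Or.inl x0
      by_cases x1 : x = w 0
      · exact Or.inr (Or.inl x1)
      refine Or.inr (Or.inr ?_)
      have hle : x < w 0 := by
        by_contra! hle
        have := hx (w 0) (lt_of_le_of_ne hle (Ne.symm x1))
        rw [h.apply_apply_zero] at this
        exact absurd this (Fin.le_last _).not_gt
      have hx0 := hx 0 (Fin.pos_iff_ne_zero.2 x0)
      rw [Fin.ext_iff] at x0 x1
      rw [Fin.lt_def] at hle
      obtain ⟨y, rfl⟩ := hp.exists_innerEmb_eq (x := x) x0 x1 (fun e => by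
        have : x = (w 0).rev := by rw [Fin.ext_iff, Fin.val_rev]; omega
        rw [this, h.apply_rev_apply_zero] at hx0
        exact Nat.not_lt_zero _ (Fin.lt_def.1 hx0)) (by have := hp.2.1; omega)
      refine ⟨y, ⟨?_, ?_⟩, rfl⟩
      · rw [mem_leftMaxima]
        intro i hi
        rw [← hv.lt_iff]
        exact hx _ (hm hi)
      · rw [← hm.lt_iff_lt, Fin.lt_def, hs.1]; omega
    · rintro (rfl | rfl | ⟨y, ⟨hy, hyq⟩, rfl⟩) <;> rw [mem_leftMaxima]
      · intro i hi
        exact absurd hi (Fin.zero_le _).not_gt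
      · intro i hi
        refine lt_of_le_of_ne ?_ (fun e => hi.ne (w.injective e))
        rw [h.apply_apply_zero]
        exact Fin.le_last _
      · have h0 := hv.lt_innerEmb_of_mem_leftMaxima h' hq hy hs.1
        have hyq' := hm hyq
        rw [Fin.lt_def, hs.1] at hyq'
        intro i hi
        rw [Fin.lt_def] at hi
        by_cases i0 : (i : ℕ) = 0
        · have : i = 0 := Fin.ext i0
          rwa [this]
        by_cases i1 : (i : ℕ) = n + 3 - w 0
        · have : i = (w 0).rev := by rw [Fin.ext_iff, Fin.val_rev]; omega
          rw [this, h.apply_rev_apply_zero]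
          exact lt_of_le_of_lt (Fin.zero_le _) h0
        obtain ⟨z, rfl⟩ := hp.exists_innerEmb_eq i0 (by omega) i1 (by have := hp.2.1; omega)
        rw [hv.lt_iff]
        exact mem_leftMaxima.1 hy _ (hm.lt_iff_lt.1 hi)
  rw [key, Finset.card_insert_of_notMem, Finset.card_insert_of_notMem,
    Finset.card_image_of_injective _ hm.injective]
  · simp only [Finset.mem_image, not_exists, not_and]
    intro y _ e
    exact (hp.innerEmb_ne y).2.1 (by rw [e])
  · simp only [Finset.mem_insert, Finset.mem_image, not_or, not_exists, not_and]
    refine ⟨fun e => ?_, fun y _ e => (hp.innerEmb_ne y).1 (by rw [e]; rfl)⟩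
    have := hp.1
    rw [← e] at this
    exact lt_irrefl _ this

/-! ### Extension at a site preserves the Baxter property -/

namespace IsLeftSite

variable {n : ℕ} {w : Equiv.Perm (Fin (n + 4))} {v : Equiv.Perm (Fin n)} {s : Fin (n + 4)}

theorem rev_apply_lt (hs : IsLeftSite w s) (h : IsQuarterTurn w) {x : Fin (n + 4)} (hx : x ≠ 0)
    (hxs : w x < s) : (w s).rev < x := by
  by_contra! hle
  rcases hle.eq_or_lt with e | e
  · rw [e, h.apply_rev_apply] at hxs
    exact lt_irrefl _ hxs
  · exact lt_asymm hxs (hs.lt_apply h hx e)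

theorem lt_apply_of_rev_lt (hs : IsLeftSite w s) (h : IsQuarterTurn w) {x : Fin (n + 4)}
    (hx : x ≠ Fin.last (n + 3)) (hxs : s.rev < w x) : x < w s := by
  by_contra! hle
  rcases hle.eq_or_lt with e | e
  · rw [← e, h] at hxs
    exact lt_irrefl _ hxs
  · exact lt_asymm hxs (hs.apply_lt_rev h hx e)

/-- The inner position of the entry just above the first one. -/
theorem exists_innerEmb_apply_eq (hs : IsLeftSite w s) (h : IsQuarterTurn w) (hv : IsInner w v) :
    ∃ r, innerEmb (w 0) r = (w s).rev := by
  obtain ⟨q, hq⟩ := hs.exists_innerEmb_eq h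
  exact ⟨(v q).rev, by rw [h.isOuterPosition.innerEmb_rev, ← hv, hq]⟩

theorem exists_innerEmb_apply_eq' (hs : IsLeftSite w s) (h : IsQuarterTurn w)
    (hv : IsInner w v) : ∃ r, innerEmb (w 0) r = w s := by
  obtain ⟨q, hq⟩ := hs.exists_innerEmb_eq h
  exact ⟨v q, by rw [← hv, hq]⟩

/-- Each outer point of an occurrence is replaced by an inner neighbour: the first and last entries
by the inner entries next to them in value, the maximum and minimum by the inner entries next to
them in position (`s` and `s.rev`). -/
theorem not_contains3142 (hs : IsLeftSite w s) (h : IsQuarterTurn w) (hv : IsInner w v)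
    (hb : ¬ Contains3142 v) : ¬ Contains3142 w := by
  rintro ⟨i, j, j', k, hij, hjj, hjk, hjk', hki', hij'⟩
  apply hb
  have hp := h.isOuterPosition
  have hm := innerEmb_strictMono (w 0)
  have hs1 := hs.1
  have hl := h.apply_last
  have ht := h.apply_apply_zero
  have hz := h.apply_rev_apply_zero
  obtain ⟨p1, p2, p3⟩ := id hp
  obtain ⟨I, hI1, hI2, hI3⟩ : ∃ I, innerEmb (w 0) I < j ∧ w k < w (innerEmb (w 0) I) ∧
      w (innerEmb (w 0) I) < w j' := by
    by_cases i0 : (i : ℕ) = 0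
    · obtain ⟨r, hr⟩ := hs.exists_innerEmb_apply_eq h hv
      have ei : i = 0 := Fin.ext i0
      subst ei
      have hwr : w (w s).rev = s := h.apply_rev_apply s
      have hj : (w s).rev < j := hs.rev_apply_lt h (Fin.pos_iff_ne_zero.1 hij)
        (by rw [Fin.lt_def] at *; omega)
      refine ⟨r, by rwa [hr], by rw [hr, hwr, Fin.lt_def] at *; omega, ?_⟩
      rw [hr, hwr]
      have hne : s ≠ w j' := by
        intro e
        rw [← hwr] at e
        have := w.injective e
        rw [this, Fin.lt_def] at hj
        omega
      rw [Ne, Fin.ext_iff] at hne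
      rw [Fin.lt_def] at hij' ⊢
      omega
    · obtain ⟨I, rfl⟩ := hp.exists_innerEmb_eq (x := i) i0
        (fun e => by rw [Fin.ext e, ht] at hij'; exact absurd hij' (Fin.le_last _).not_gt)
        (fun e => by
          have : i = (w 0).rev := by rw [Fin.ext_iff, Fin.val_rev]; omega
          rw [this, hz] at hki'; exact absurd hki' (Fin.zero_le _).not_gt)
        (by rw [Fin.lt_def] at hij; omega)
      exact ⟨I, hij, hki', hij'⟩
  obtain ⟨K, hK1, hK2, hK3⟩ : ∃ K, j' < innerEmb (w 0) K ∧ w j < w (innerEmb (w 0) K) ∧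
      w (innerEmb (w 0) K) < w (innerEmb (w 0) I) := by
    by_cases k0 : (k : ℕ) = n + 3
    · obtain ⟨r, hr⟩ := hs.exists_innerEmb_apply_eq' h hv
      have ek : k = Fin.last (n + 3) := Fin.ext k0
      subst ek
      have hwr : w (w s) = s.rev := h s
      have hlv : ((w 0).rev : ℕ) = n + 3 - w 0 := by rw [Fin.val_rev]; omega
      have hsv : (s.rev : ℕ) = n + 3 - s := by rw [Fin.val_rev]; omega
      have hj : j' < w s := hs.lt_apply_of_rev_lt h hjk.ne
        (by rw [hl] at hI2; rw [Fin.lt_def] at *; omega)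
      refine ⟨r, by rwa [hr], ?_, by
        rw [hl] at hI2; rw [hr, hwr]; rw [Fin.lt_def] at *; omega⟩
      rw [hr, hwr]
      have hne : w j ≠ s.rev := by
        intro e
        rw [← hwr] at e
        have := w.injective e
        rw [← this, Fin.lt_def] at hj
        omega
      rw [Ne, Fin.ext_iff] at hne
      rw [hl] at hjk'
      rw [Fin.lt_def] at hjk' ⊢
      omega
    · obtain ⟨K, rfl⟩ := hp.exists_innerEmb_eq (x := k) (by rw [Fin.lt_def] at hjk; omega)
        (fun e => by rw [Fin.ext e, ht] at hki'; exact absurd hki' (Fin.le_last _).not_gt)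
        (fun e => by
          have : k = (w 0).rev := by rw [Fin.ext_iff, Fin.val_rev]; omega
          rw [this, hz] at hjk'; exact absurd hjk' (Fin.zero_le _).not_gt)
        k0
      exact ⟨K, hjk, hjk', hI2⟩
  obtain ⟨J', hJ1, hJ2, hJ3⟩ : ∃ J', (innerEmb (w 0) J' = j' ∨ j' = w 0 ∧
      (innerEmb (w 0) J' : ℕ) = w 0 + 1) ∧ J' < K ∧
      w (innerEmb (w 0) I) < w (innerEmb (w 0) J') := by
    by_cases j0 : j' = w 0
    · obtain ⟨q, hq⟩ := hs.exists_innerEmb_eq h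
      have hlt : w (innerEmb (w 0) I) < w (innerEmb (w 0) q) := by
        rw [hq]
        refine hs.2 _ ?_
        rw [Fin.ext_iff] at j0
        rw [Fin.lt_def] at *
        omega
      refine ⟨q, Or.inr ⟨j0, by rw [hq, hs1]⟩, ?_, hlt⟩
      have hne : q ≠ K := fun e => by
        rw [e] at hlt; exact lt_asymm hlt hK3
      refine lt_of_le_of_ne (hm.le_iff_le.1 ?_) hne
      rw [Fin.ext_iff] at j0
      rw [hq, Fin.le_def, hs1]
      rw [Fin.lt_def] at hK1
      omega
    · obtain ⟨J', rfl⟩ := hp.exists_innerEmb_eq (x := j') (by omega)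
        (fun e => j0 (Fin.ext e))
        (fun e => by
          have : j' = (w 0).rev := by rw [Fin.ext_iff, Fin.val_rev]; omega
          rw [this, hz] at hij'; exact absurd hij' (Fin.zero_le _).not_gt)
        (by rw [Fin.lt_def] at hjk; omega)
      exact ⟨J', Or.inl rfl, hm.lt_iff_lt.1 hK1, hI3⟩
  obtain ⟨J, hL1, hL2, hL3⟩ : ∃ J, (innerEmb (w 0) J = j ∨ j = (w 0).rev ∧
      (innerEmb (w 0) J : ℕ) = s.rev) ∧ I < J ∧
      w (innerEmb (w 0) J) < w (innerEmb (w 0) K) := by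
    by_cases j0 : j = (w 0).rev
    · obtain ⟨q, hq⟩ := hs.exists_innerEmb_eq h
      have hq' : innerEmb (w 0) q.rev = s.rev := by rw [hp.innerEmb_rev, hq]
      have hlt : w (innerEmb (w 0) q.rev) < w (innerEmb (w 0) K) := by
        rw [hq']
        refine hs.apply_rev_lt h ?_
        rw [← j0]
        rw [Fin.lt_def] at *
        omega
      refine ⟨q.rev, Or.inr ⟨j0, by rw [hq']⟩, ?_, hlt⟩
      have hne : I ≠ q.rev := fun e => by
        rw [← e] at hlt; exact lt_asymm hlt hK3
      refine lt_of_le_of_ne (hm.le_iff_le.1 ?_) hne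
      rw [hq', Fin.le_def, Fin.val_rev]
      rw [Fin.ext_iff, Fin.val_rev] at j0
      rw [Fin.lt_def] at hI1
      omega
    · obtain ⟨J, rfl⟩ := hp.exists_innerEmb_eq (x := j) (by rw [Fin.lt_def] at hij; omega)
        (fun e => by rw [Fin.ext e, ht] at hjk'; exact absurd hjk' (Fin.le_last _).not_gt)
        (fun e => j0 (by rw [Fin.ext_iff, Fin.val_rev]; omega))
        (by rw [Fin.lt_def] at hjk; omega)
      exact ⟨J, Or.inl rfl, hm.lt_iff_lt.1 hI1, hK2⟩
  refine ⟨I, J, J', K, hL2, ?_, hJ2, hv.lt_iff.1 hL3, hv.lt_iff.1 hK3, hv.lt_iff.1 hJ3⟩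
  simp only [Fin.ext_iff, Fin.val_rev] at hL1 hJ1
  have hlt : J < J' := by
    rw [← hm.lt_iff_lt, Fin.lt_def]
    omega
  -- An inner column between `J` and `J'` would lie strictly between the two chosen columns, where
  -- only deleted columns fit.
  by_contra hne
  rw [Fin.lt_def] at hlt
  have hJ' := J'.isLt
  have h1 := hm (show J < ⟨J + 1, by omega⟩ by simp [Fin.lt_def])
  have h2 := hm (show ⟨J + 1, by omega⟩ < J' by rw [Fin.lt_def]; dsimp only; omega)
  have h3 := hp.innerEmb_ne ⟨J + 1, by omega⟩
  rw [Fin.lt_def] at h1 h2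
  omega

/-- The site condition and its half turn prevent the maximum and the minimum from being the adjacent
middle entries, so only the first and last entries need replacing. -/
theorem not_contains2413 (hs : IsLeftSite w s) (h : IsQuarterTurn w) (hv : IsInner w v)
    (hb : ¬ Contains2413 v) : ¬ Contains2413 w := by
  rintro ⟨i, j, j', k, hij, hjj, hjk, hji', hik', hkj'⟩
  apply hb
  have hp := h.isOuterPosition
  have hm := innerEmb_strictMono (w 0)
  have hs1 := hs.1
  have hl := h.apply_last
  have ht := h.apply_apply_zero
  have hz := h.apply_rev_apply_zero
  obtain ⟨p1, p2, p3⟩ := id hp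
  have hj'0 : j' ≠ 0 := by rw [Ne, Fin.ext_iff, Fin.val_zero]; omega
  have hjl : j ≠ Fin.last (n + 3) := by
    rw [Ne, Fin.ext_iff, Fin.val_last]; rw [Fin.lt_def] at hjk; omega
  obtain ⟨J, rfl⟩ := hp.exists_innerEmb_eq (x := j) (by rw [Fin.lt_def] at hij; omega)
    (fun e => by
      rw [Fin.ext e] at hij
      have e' : j' = s := by rw [Fin.ext_iff]; omega
      rw [e'] at hji'
      exact lt_asymm hji' (hs.2 _ hij))
    (fun e => by
      have : j = (w 0).rev := by rw [Fin.ext_iff, Fin.val_rev]; omega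
      rw [this, hz] at hkj'; exact absurd hkj' (Fin.zero_le _).not_gt)
    (by rw [Fin.lt_def] at hjk; omega)
  obtain ⟨J', rfl⟩ := hp.exists_innerEmb_eq (x := j') (by omega)
    (fun e => by rw [Fin.ext e, ht] at hji'; exact absurd hji' (Fin.le_last _).not_gt)
    (fun e => by
      have : j' = (w 0).rev := by rw [Fin.ext_iff, Fin.val_rev]; omega
      rw [this] at hjk
      have e' : innerEmb (w 0) J = s.rev := by rw [Fin.ext_iff, Fin.val_rev]; omega
      rw [e'] at hkj'
      exact lt_asymm hkj' (hs.apply_rev_lt h hjk))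
    (by rw [Fin.lt_def] at hjk; omega)
  obtain ⟨I, hI1, hI2, hI3⟩ : ∃ I, I < J ∧ w (innerEmb (w 0) J') < w (innerEmb (w 0) I) ∧
      w (innerEmb (w 0) I) < w k := by
    by_cases i0 : (i : ℕ) = 0
    · obtain ⟨r, hr⟩ := hs.exists_innerEmb_apply_eq h hv
      have ei : i = 0 := Fin.ext i0
      subst ei
      have hwr : w (innerEmb (w 0) r) = s := by rw [hr, h.apply_rev_apply]
      have hj := hs.rev_apply_lt h hj'0 (by rw [Fin.lt_def] at *; omega)
      rw [← hr] at hj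
      have hsk : s < w k := by
        have hne : s ≠ w k := by
          intro e
          rw [← hwr] at e
          have := w.injective e
          rw [← this] at hjk
          exact lt_asymm hjk hj
        rw [Ne, Fin.ext_iff] at hne
        rw [Fin.lt_def] at hik' ⊢
        omega
      refine ⟨r, ?_, by rw [hwr]; rw [Fin.lt_def] at *; omega, by rwa [hwr]⟩
      have hne : r ≠ J := by
        rintro rfl
        rw [hwr] at hkj'
        exact lt_asymm hkj' hsk
      refine lt_of_le_of_ne (hm.le_iff_le.1 ?_) hne
      rw [Fin.lt_def] at hj
      rw [Fin.le_def]
      omega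
    · obtain ⟨I, rfl⟩ := hp.exists_innerEmb_eq (x := i) i0
        (fun e => by rw [Fin.ext e, ht] at hik'; exact absurd hik' (Fin.le_last _).not_gt)
        (fun e => by
          have : i = (w 0).rev := by rw [Fin.ext_iff, Fin.val_rev]; omega
          rw [this, hz] at hji'; exact absurd hji' (Fin.zero_le _).not_gt)
        (by rw [Fin.lt_def] at hij; omega)
      exact ⟨I, hm.lt_iff_lt.1 hij, hji', hik'⟩
  obtain ⟨K, hK1, hK2, hK3⟩ : ∃ K, J' < K ∧ w (innerEmb (w 0) I) < w (innerEmb (w 0) K) ∧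
      w (innerEmb (w 0) K) < w (innerEmb (w 0) J) := by
    by_cases k0 : (k : ℕ) = n + 3
    · obtain ⟨r, hr⟩ := hs.exists_innerEmb_apply_eq' h hv
      have ek : k = Fin.last (n + 3) := Fin.ext k0
      subst ek
      have hwr : w (innerEmb (w 0) r) = s.rev := by rw [hr, h]
      have hlv : ((w 0).rev : ℕ) = n + 3 - w 0 := by rw [Fin.val_rev]; omega
      have hsv : (s.rev : ℕ) = n + 3 - s := by rw [Fin.val_rev]; omega
      rw [hl] at hkj' hI3
      have hj := hs.lt_apply_of_rev_lt h hjl (by rw [Fin.lt_def] at *; omega)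
      rw [← hr] at hj
      have hsk : w (innerEmb (w 0) I) < s.rev := by
        have hne : w (innerEmb (w 0) I) ≠ s.rev := by
          intro e
          rw [← hwr] at e
          have := w.injective e
          rw [← this] at hj
          exact lt_asymm (hm hI1) hj
        rw [Ne, Fin.ext_iff] at hne
        rw [Fin.lt_def] at hI3 ⊢
        omega
      refine ⟨r, ?_, by rwa [hwr], by rw [hwr]; rw [Fin.lt_def] at *; omega⟩
      have hne : J' ≠ r := by
        rintro rfl
        rw [hwr] at hI2
        exact lt_asymm hI2 hsk
      refine lt_of_le_of_ne (hm.le_iff_le.1 ?_) hne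
      rw [Fin.lt_def] at hj
      rw [Fin.le_def]
      omega
    · obtain ⟨K, rfl⟩ := hp.exists_innerEmb_eq (x := k) (by rw [Fin.lt_def] at hjk; omega)
        (fun e => by rw [Fin.ext e, ht] at hkj'; exact absurd hkj' (Fin.le_last _).not_gt)
        (fun e => by
          have : k = (w 0).rev := by rw [Fin.ext_iff, Fin.val_rev]; omega
          rw [this, hz] at hik'; exact absurd hik' (Fin.zero_le _).not_gt)
        k0
      exact ⟨K, hm.lt_iff_lt.1 hjk, hI3, hkj'⟩
  refine ⟨I, J, J', K, hI1, ?_, hK1, hv.lt_iff.1 hI2, hv.lt_iff.1 hK2, hv.lt_iff.1 hK3⟩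
  have hlt : J < J' := by
    rw [← hm.lt_iff_lt, Fin.lt_def]
    omega
  by_contra hne
  rw [Fin.lt_def] at hlt
  have hJ' := J'.isLt
  have h1 := hm (show J < ⟨J + 1, by omega⟩ by simp [Fin.lt_def])
  have h2 := hm (show ⟨J + 1, by omega⟩ < J' by rw [Fin.lt_def]; dsimp only; omega)
  rw [Fin.lt_def] at h1 h2
  omega

theorem isBaxter (hs : IsLeftSite w s) (h : IsQuarterTurn w) (hv : IsInner w v)
    (hb : IsBaxter v) : IsBaxter w :=
  ⟨hs.not_contains3142 h hv hb.1, hs.not_contains2413 h hv hb.2⟩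

end IsLeftSite

/-! ### Enumeration -/

open Classical in
/-- The quarter-turn symmetric Baxter permutations of length `n`, as a finset. -/
noncomputable def quarterTurnBaxterFinset (n : ℕ) : Finset (Equiv.Perm (Fin n)) :=
  Finset.univ.filter fun w => IsQuarterTurn w ∧ IsBaxter w

theorem mem_quarterTurnBaxterFinset {n : ℕ} {w : Equiv.Perm (Fin n)} :
    w ∈ quarterTurnBaxterFinset n ↔ IsQuarterTurn w ∧ IsBaxter w := by
  simp [quarterTurnBaxterFinset]

theorem ncard_quarterTurnBaxter (n : ℕ) :
    (quarterTurnBaxter n).ncard = (quarterTurnBaxterFinset n).card := by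
  rw [← Set.ncard_coe_finset]
  congr 1
  ext w
  rw [Finset.mem_coe, mem_quarterTurnBaxterFinset, quarterTurnBaxter, Set.mem_ofPred_eq,
    rotate90_permMatrix_eq_iff, and_comm]

theorem mirror_mem_quarterTurnBaxterFinset {n : ℕ} {w : Equiv.Perm (Fin n)}
    (h : w ∈ quarterTurnBaxterFinset n) : mirror w ∈ quarterTurnBaxterFinset n := by
  rw [mem_quarterTurnBaxterFinset] at h ⊢
  exact ⟨h.1.mirror, h.2.mirror⟩

theorem quarterTurnBaxterFinset_add_four_eq_empty {n : ℕ} (h : quarterTurnBaxterFinset n = ∅) :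
    quarterTurnBaxterFinset (n + 4) = ∅ := by
  rw [Finset.eq_empty_iff_forall_notMem] at h ⊢
  intro w hw
  rw [mem_quarterTurnBaxterFinset] at hw
  obtain ⟨v, hv, hwv⟩ := hw.1.exists_isInner
  exact h v (mem_quarterTurnBaxterFinset.2 ⟨hv, hw.2.of_isInner hw.1 hwv⟩)

theorem quarterTurnBaxterFinset_two : quarterTurnBaxterFinset 2 = ∅ := by
  rw [Finset.eq_empty_iff_forall_notMem]
  intro w hw
  have : ∀ w : Equiv.Perm (Fin 2), ¬ ∀ x, w (w x) = x.rev := by decide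
  exact this w (mem_quarterTurnBaxterFinset.1 hw).1

theorem quarterTurnBaxterFinset_three : quarterTurnBaxterFinset 3 = ∅ := by
  rw [Finset.eq_empty_iff_forall_notMem]
  intro w hw
  have : ∀ w : Equiv.Perm (Fin 3), ¬ ∀ x, w (w x) = x.rev := by decide
  exact this w (mem_quarterTurnBaxterFinset.1 hw).1

/-- The empty permutation is Baxter, so length 4 needs its own argument: the only two symmetric
candidates are 2413 and 3142 themselves. -/
theorem quarterTurnBaxterFinset_four : quarterTurnBaxterFinset 4 = ∅ := by
  rw [Finset.eq_empty_iff_forall_notMem]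
  intro w hw
  obtain ⟨h, hb⟩ := mem_quarterTurnBaxterFinset.1 hw
  have h1 := IsQuarterTurn.apply_apply_zero (n := 0) h
  have h2 := IsQuarterTurn.apply_last (n := 0) h
  have h3 := IsQuarterTurn.apply_rev_apply_zero (n := 0) h
  obtain ⟨p1, p2, p3⟩ := IsQuarterTurn.isOuterPosition (n := 0) h
  have hp : w 0 = 1 ∨ w 0 = 2 := by
    simp only [Fin.ext_iff]
    simp
    omega
  rcases hp with hp | hp
  · rw [hp] at h1 h2 h3
    refine hb.2 ⟨0, 1, 2, 3, by decide, rfl, by decide, ?_, ?_, ?_⟩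
    · rw [show w 2 = 0 from h3, hp]; decide
    · rw [show w 3 = 2 from h2, hp]; decide
    · rw [show w 3 = 2 from h2, show w 1 = 3 from h1]; decide
  · rw [hp] at h1 h2 h3
    refine hb.1 ⟨0, 1, 2, 3, by decide, rfl, by decide, ?_, ?_, ?_⟩
    · rw [show w 1 = 0 from h3, show w 3 = 1 from h2]; decide
    · rw [show w 3 = 1 from h2, hp]; decide
    · rw [hp, show w 2 = 3 from h1]; decide

theorem quarterTurnBaxterFinset_eq_empty (n : ℕ) (hn : 1 ≤ n) (h : n % 4 ≠ 1) :
    quarterTurnBaxterFinset n = ∅ := by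
  induction n using Nat.strong_induction_on with
  | _ n ih =>
    by_cases h5 : n < 5
    · have : n = 2 ∨ n = 3 ∨ n = 4 := by omega
      rcases this with rfl | rfl | rfl
      · exact quarterTurnBaxterFinset_two
      · exact quarterTurnBaxterFinset_three
      · exact quarterTurnBaxterFinset_four
    · obtain ⟨m, rfl⟩ : ∃ m, n = m + 4 := ⟨n - 4, by omega⟩
      exact quarterTurnBaxterFinset_add_four_eq_empty (ih m (by omega) (by omega) (by omega))

/-- The site to the left of `q` is available for the maximal entry of an extension. -/
theorem exists_isOuterPosition {n : ℕ} (hn : Odd n) (q : Fin n) :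
    ∃ p : Fin (n + 4), IsOuterPosition p ∧ (innerEmb p q : ℕ) = p + 1 := by
  obtain ⟨a, ha⟩ := hn
  have hq := q.isLt
  -- The columns inserted before `q` are `0` and `p`, and also `p.rev` when `q` is in the right
  -- half.
  refine ⟨⟨if 2 * (q : ℕ) < n then q + 1 else q + 2, by split_ifs <;> omega⟩, ?_, ?_⟩
  · simp only [IsOuterPosition]
    split_ifs <;> omega
  · rw [innerEmb_val]
    dsimp only
    split_ifs <;> omega

theorem IsOuterPosition.eq_of_innerEmb {n : ℕ} {p p' : Fin (n + 4)} (hp : IsOuterPosition p)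
    (hp' : IsOuterPosition p') {q : Fin n} (h : (innerEmb p q : ℕ) = p + 1)
    (h' : (innerEmb p' q : ℕ) = p' + 1) (hn : Odd n) : p = p' := by
  obtain ⟨a, ha⟩ := hn
  obtain ⟨h1, h2, h3⟩ := hp
  obtain ⟨h1', h2', h3'⟩ := hp'
  rw [innerEmb_val] at h h'
  rw [Fin.ext_iff]
  split_ifs at h h' <;> omega

open Classical in
/-- Summing over the left type extensions of all symmetric Baxter permutations of length `n`. -/
theorem sum_filter_apply_zero_lt_apply_one {n : ℕ} (hn : Odd n) (g : ℕ → ℕ) :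
    ∑ w ∈ (quarterTurnBaxterFinset (n + 4)).filter (fun w => w 0 < w 1),
      g (leftMaxima w).card =
    ∑ v ∈ quarterTurnBaxterFinset n, ∑ l ∈ Finset.range (leftMaxima v).card, g (l + 2) := by
  have key : ∀ w : Equiv.Perm (Fin (n + 4)), ∃ (v : Equiv.Perm (Fin n)) (q : Fin n),
      w ∈ (quarterTurnBaxterFinset (n + 4)).filter (fun w => w 0 < w 1) →
      IsQuarterTurn v ∧ IsInner w v ∧ IsLeftSite w (innerEmb (w 0) q) := by
    intro w
    by_cases hw : w ∈ (quarterTurnBaxterFinset (n + 4)).filter (fun w => w 0 < w 1)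
    · have hw' := hw
      rw [Finset.mem_filter, mem_quarterTurnBaxterFinset] at hw'
      obtain ⟨⟨h, hb⟩, h01⟩ := hw'
      obtain ⟨v, hv, hwv⟩ := h.exists_isInner
      obtain ⟨s, hs⟩ := hb.exists_isLeftSite h h01
      obtain ⟨q, rfl⟩ := hs.exists_innerEmb_eq h
      exact ⟨v, q, fun _ => ⟨hv, hwv, hs⟩⟩
    -- Arbitrary values outside the index set.
    · exact ⟨1, ⟨0, hn.pos⟩, fun h => absurd h hw⟩
  choose v q hvq using key
  -- Labels become ranks of left-to-right maxima, so the sum runs over pairs of an inner permutation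
  -- and a site.
  simp_rw [← Finset.sum_rank (leftMaxima _) (fun l => g (l + 2))]
  rw [Finset.sum_sigma']
  refine Finset.sum_bij (fun w _ => ⟨v w, q w⟩) ?_ ?_ ?_ ?_
  · intro w hw
    obtain ⟨h1, h2, h3⟩ := hvq w hw
    rw [Finset.mem_filter, mem_quarterTurnBaxterFinset] at hw
    rw [Finset.mem_sigma, mem_quarterTurnBaxterFinset]
    exact ⟨⟨h1, hw.1.2.of_isInner hw.1.1 h2⟩, h3.mem_leftMaxima h2 hw.1.1⟩
  · intro w hw w' hw' e
    obtain ⟨h1, h2, h3⟩ := hvq w hw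
    obtain ⟨h1', h2', h3'⟩ := hvq w' hw'
    rw [Finset.mem_filter, mem_quarterTurnBaxterFinset] at hw hw'
    simp only [Sigma.mk.injEq, heq_eq_eq] at e
    rw [← e.1] at h2'
    rw [← e.2] at h3'
    exact h2.ext h2' hw.1.1 hw'.1.1 (hw.1.1.isOuterPosition.eq_of_innerEmb
      hw'.1.1.isOuterPosition h3.1 h3'.1 hn)
  · rintro ⟨u, r⟩ hu
    rw [Finset.mem_sigma, mem_quarterTurnBaxterFinset] at hu
    obtain ⟨⟨hu, hub⟩, hr⟩ := hu
    obtain ⟨p, hp, hpr⟩ := exists_isOuterPosition hn r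
    obtain ⟨w, hw, rfl, hwu⟩ := hu.exists_extension hp
    have hs := hwu.isLeftSite hw hu hr hpr
    have hmem : w ∈ (quarterTurnBaxterFinset (n + 4)).filter (fun w => w 0 < w 1) := by
      rw [Finset.mem_filter, mem_quarterTurnBaxterFinset]
      exact ⟨⟨hw, hs.isBaxter hw hwu hub⟩, hs.apply_zero_lt_apply_one hw⟩
    obtain ⟨h1, h2, h3⟩ := hvq w hmem
    refine ⟨w, hmem, ?_⟩
    have e : q w = r := (innerEmb_strictMono (w 0)).injective
      (by rw [Fin.ext_iff, h3.1, hpr])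
    rw [h2.unique hwu, e]
  · intro w hw
    obtain ⟨h1, h2, h3⟩ := hvq w hw
    rw [Finset.mem_filter, mem_quarterTurnBaxterFinset] at hw
    rw [h2.card_leftMaxima hw.1.1 h1 h3]

open Classical in
-- The mirror image exchanges `w 0 < w 1` with `w 1 < w 0` and keeps the number of left-to-right
-- maxima, whence the factor 2.
theorem sum_quarterTurnBaxterFinset_add_four {n : ℕ} (hn : Odd n) (g : ℕ → ℕ) :
    ∑ w ∈ quarterTurnBaxterFinset (n + 4), g (leftMaxima w).card =
    2 * ∑ v ∈ quarterTurnBaxterFinset n, ∑ l ∈ Finset.range (leftMaxima v).card, g (l + 2) := by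
  rw [← sum_filter_apply_zero_lt_apply_one hn,
    ← Finset.sum_filter_add_sum_filter_not _ (fun w : Equiv.Perm (Fin (n + 4)) => w 0 < w 1),
    two_mul]
  congr 1
  have h01 : ∀ w : Equiv.Perm (Fin (n + 4)), w 1 ≠ w 0 := fun w e => by
    have := w.injective e
    rw [Fin.ext_iff] at this; simp at this
  refine Finset.sum_bij' (fun w _ => mirror w) (fun w _ => mirror w) ?_ ?_
    (fun w _ => mirror_mirror w) (fun w _ => mirror_mirror w) ?_
  · intro w hw
    rw [Finset.mem_filter, not_lt] at hw
    rw [Finset.mem_filter, mirror_apply, mirror_apply, Fin.rev_lt_rev]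
    exact ⟨mirror_mem_quarterTurnBaxterFinset hw.1, lt_of_le_of_ne hw.2 (h01 w)⟩
  · intro w hw
    rw [Finset.mem_filter] at hw
    rw [Finset.mem_filter, mirror_apply, mirror_apply, Fin.rev_lt_rev]
    exact ⟨mirror_mem_quarterTurnBaxterFinset hw.1, lt_asymm hw.2⟩
  · intro w hw
    rw [Finset.mem_filter, mem_quarterTurnBaxterFinset] at hw
    rw [hw.1.1.card_leftMaxima_mirror]

/-- The weight `treeCount d` lets the induction trade one level of permutations for one level of the
tree; at `d = 0` it is a plain count. -/
theorem sum_treeCount_quarterTurnBaxterFinset (m d : ℕ) :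
    ∑ w ∈ quarterTurnBaxterFinset (4 * m + 1), treeCount d (leftMaxima w).card =
      2 ^ m * treeCount (m + d) 1 := by
  induction m generalizing d with
  | zero =>
    have : Subsingleton (Fin (4 * 0 + 1)) := inferInstanceAs (Subsingleton (Fin 1))
    have h1 : quarterTurnBaxterFinset (4 * 0 + 1) = {1} := by
      ext w
      rw [mem_quarterTurnBaxterFinset, Finset.mem_singleton]
      refine ⟨fun _ => Subsingleton.elim _ _, fun _ => ⟨fun x => Subsingleton.elim _ _, ?_, ?_⟩⟩
      · rintro ⟨i, j, j', k, h, -⟩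
        exact h.ne (Subsingleton.elim _ _)
      · rintro ⟨i, j, j', k, h, -⟩
        exact h.ne (Subsingleton.elim _ _)
    have h2 : leftMaxima (1 : Equiv.Perm (Fin (4 * 0 + 1))) = {0} := by
      ext x
      rw [mem_leftMaxima, Finset.mem_singleton]
      exact ⟨fun _ => Subsingleton.elim _ _, fun _ i hi => absurd (Subsingleton.elim _ _) hi.ne⟩
    rw [h1, Finset.sum_singleton, h2, Finset.card_singleton]
    simp
  | succ m ih =>
    have := sum_quarterTurnBaxterFinset_add_four (n := 4 * m + 1) ⟨2 * m, by ring⟩ (treeCount d)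
    rw [show 4 * (m + 1) + 1 = 4 * m + 1 + 4 by ring, this]
    -- The inner sum unfolds definitionally from `treeCount (d + 1)`.
    have ih' : ∑ v ∈ quarterTurnBaxterFinset (4 * m + 1),
        ∑ l ∈ Finset.range (leftMaxima v).card, treeCount d (l + 2) =
        2 ^ m * treeCount (m + (d + 1)) 1 := ih (d + 1)
    rw [ih', show m + 1 + d = m + (d + 1) by ring]
    ring

theorem theorem1 (n : ℕ) (hn : 1 ≤ n) :
    (∀ m : ℕ, n = 4 * m + 1 → (quarterTurnBaxter n).ncard = 2 ^ m * catalan m) ∧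
    ((¬ ∃ m : ℕ, n = 4 * m + 1) → (quarterTurnBaxter n).ncard = 0) := by
  constructor
  · rintro m rfl
    have := sum_treeCount_quarterTurnBaxterFinset m 0
    simp only [treeCount, Finset.sum_const, smul_eq_mul, mul_one, add_zero] at this
    rw [ncard_quarterTurnBaxter, this, treeCount_one]
  · intro h
    rw [ncard_quarterTurnBaxter, quarterTurnBaxterFinset_eq_empty n hn, Finset.card_empty]
    intro h4
    exact h ⟨n / 4, by omega⟩
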